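/- Let $(M,d)$ be a complete separable metric space with its Borel $\sigma$-field, and let $C:[0,\infty)\to[0,\infty)$ be continuous and non-decreasing with $C(0)=0$. Suppose that $C$ satisfies the doubling condition: there is a constant $\lambda>0$ with $C(2y)\le\lambda C(y)$ for all $y\ge 0$. For Borel probability measures $\mu,\nu$ on $M$ put $$T_c(\mu,\nu)=\inf_{\pi}\int_{M\times M} C(d(x,y))\,d\pi(x,y),$$ where the infimum is over all probability measures $\pi$ on $M\times M$ with marginals $\mu$ and $\nu$. Let $\mu$ and $\mu_n$ ($n\in\mathbb N$) be Borel probability measures on $M$. (i) For every $a\in M$, the condition $$\int C(2d(x,a))\,\mu_n(dx)<\infty\ \text{ for all } n,\qquad \int C(2d(x,a))\,\mu(dx)<\infty \qquad (*)$$ is equivalent to $$\int C(d(x,a))\,\mu_n(dx)<\infty\ \text{ for all } n,\qquad \int C(d(x,a))\,\mu(dx)<\infty .$$ (ii) If $(*)$ holds for some $a\in M$, then it holds for all $a\in M$. If, moreover, $C$ is not identically $0$, then for every $a\in M$ $$T_c(\mu_n,\mu)\to 0\iff \mu_n\Longrightarrow\mu \ \text{ weakly and } \int C(d(x,a))\,\mu_n(dx)\to\int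 C(d(x,a))\,\mu(dx).$$ (iii) (Bickel--Freedman criterion.) Let $1\le p<\infty$, let $B$ be a separable Banach space, and let $\mu$ and $\mu_n$ ($n\in\mathbb N$) be Borel probability measures on $B$ with $\int\|x\|^p\,\mu_n(dx)<\infty$ for all $n$ and $\int\|x\|^p\,\mu(dx)<\infty$. Put $W_p(\mu,\nu)=\bigl(\inf_\pi\int\|x-y\|^p\,d\pi(x,y)\bigr)^{1/p}$, the infimum being over all probability measures on $B\times B$ with marginals $\mu$ and $\nu$. Then $$W_p(\mu_n,\mu)\to 0\iff \mu_n\Longrightarrow\mu\ \text{ weakly and }\int\|x\|^p\,\mu_n(dx)\to\int\|x\|^p\,\mu(dx).$$ -/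

import Mathlib

open MeasureTheory Filter Topology
open scoped NNReal ENNReal

noncomputable section

/-- `π` is a coupling of `μ` and `ν`: its marginals are `μ` and `ν`. -/
def IsCoupling {M : Type*} [MeasurableSpace M]
    (π : ProbabilityMeasure (M × M)) (μ ν : ProbabilityMeasure M) : Prop :=
  (π : Measure (M × M)).map Prod.fst = (μ : Measure M) ∧
    (π : Measure (M × M)).map Prod.snd = (ν : Measure M)

/-- The transportation distance `T_c(μ, ν)`, the infimum of `∫ c dπ` over all probability
measures `π` on `M × M` with marginals `μ` and `ν`; it takes values in `[0, ∞]`. -/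
def transportDist {M : Type*} [MeasurableSpace M] (c : M → M → ℝ≥0)
    (μ ν : ProbabilityMeasure M) : ℝ≥0∞ :=
  ⨅ (π : ProbabilityMeasure (M × M)) (_ : IsCoupling π μ ν),
    ∫⁻ z, (c z.1 z.2 : ℝ≥0∞) ∂(π : Measure (M × M))

/-- The Wasserstein (Mallows) `p`-distance `W_p = (T_{d^p})^{1/p}`. -/
def wassersteinDist {M : Type*} [MetricSpace M] [MeasurableSpace M] (p : ℝ)
    (μ ν : ProbabilityMeasure M) : ℝ≥0∞ :=
  transportDist (fun x y => nndist x y ^ p) μ ν ^ (1 / p)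

/-- The doubling condition: `C (2y) ≤ Λ C(y)` for all `y ≥ 0`, for some constant `Λ > 0`. -/
def Doubling (C : ℝ≥0 → ℝ≥0) : Prop :=
  ∃ Λ : ℝ≥0, 0 < Λ ∧ ∀ y : ℝ≥0, C (2 * y) ≤ Λ * C y

end

/-! Doubling and monotonicity give `C (s + t) ≤ Λ * C s + Λ * C t`, so the cost is at most `f x + f
y` with `f x = Λ * C (d(x, a))`.

If `μs n` converges weakly with its moments, a cheap coupling is built by hand. Finitely many
disjoint cells of small diameter with `μ`-null boundary carry almost all of `μ`, and the cell masses
converge. Matching the common mass inside each cell (`blockCoupling`) costs little. The small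
leftovers are coupled by a normalized product, whose cost is at most the integrals of `f` over them
(`transportDist_le_of_marginals_le`). These are small because the tails `∫ (f - R)⁺` of `μs n`
converge to that of `μ`.

Conversely, a nearly optimal coupling bounds the difference of the integrals of `g` once `|g x - g
y| ≤ e y + K * C (d(x, y))` with `∫ e dμ` small (`tendsto_lintegral_of_le_add_cost`). This applies
to bounded Lipschitz functions and to `C (d(·, a))`. Since `e` depends only on `y`, only the tail of
the fixed measure `μ` matters. -/

/-! ### Completing partial couplings, and control of tails -/

theorem transportDist_le_of_marginals_le {M : Type*} [MeasurableSpace M]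
    {c : M → M → ℝ≥0} {f : M → ℝ≥0}
    (hf : Measurable f) (hcf : ∀ x y, c x y ≤ f x + f y) {μ ν : ProbabilityMeasure M}
    {κ : Measure (M × M)} (h₁ : κ.map Prod.fst ≤ μ) (h₂ : κ.map Prod.snd ≤ ν) :
    transportDist c μ ν ≤ ∫⁻ z, (c z.1 z.2 : ℝ≥0∞) ∂κ +
      (∫⁻ x, (f x : ℝ≥0∞) ∂((μ : Measure M) - κ.map Prod.fst) +
        ∫⁻ x, (f x : ℝ≥0∞) ∂((ν : Measure M) - κ.map Prod.snd)) := by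
  have hfst : κ.map Prod.fst Set.univ = κ Set.univ := by
    rw [Measure.map_apply measurable_fst MeasurableSet.univ, Set.preimage_univ]
  have hsnd : κ.map Prod.snd Set.univ = κ Set.univ := by
    rw [Measure.map_apply measurable_snd MeasurableSet.univ, Set.preimage_univ]
  have hκ1 : κ Set.univ ≤ 1 := by
    rw [← hfst]; exact (h₁ Set.univ).trans_eq measure_univ
  have : IsFiniteMeasure κ := ⟨hκ1.trans_lt ENNReal.one_lt_top⟩
  set ρ := (μ : Measure M) - κ.map Prod.fst with hρ
  set σ := (ν : Measure M) - κ.map Prod.snd with hσ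
  have hρs : ρ + κ.map Prod.fst = μ := Measure.sub_add_cancel_of_le h₁
  have hσs : σ + κ.map Prod.snd = ν := Measure.sub_add_cancel_of_le h₂
  have hρu : ρ Set.univ + κ Set.univ = 1 := by
    rw [← hfst, ← Measure.add_apply, hρs, measure_univ]
  have hσu : σ Set.univ + κ Set.univ = 1 := by
    rw [← hsnd, ← Measure.add_apply, hσs, measure_univ]
  have huu : ρ Set.univ = σ Set.univ :=
    (ENNReal.add_left_inj (measure_ne_top κ _)).1 (hρu.trans hσu.symm)
  have hρfin : IsFiniteMeasure ρ := ⟨(measure_lt_top (μ : Measure M) _).trans_le'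
    (Measure.sub_le Set.univ)⟩
  have hσfin : IsFiniteMeasure σ := ⟨(measure_lt_top (ν : Measure M) _).trans_le'
    (Measure.sub_le Set.univ)⟩
  set r := ρ Set.univ with hr
  -- If `r = 0`, then `r⁻¹ = ∞`, but the leftovers vanish, so no separate case is needed later.
  have hcancel : ∀ τ : Measure M, τ Set.univ = r → (r⁻¹ * r) • τ = τ := by
    intro τ hτ
    rcases eq_or_ne r 0 with h0 | h0
    · have : τ = 0 := Measure.measure_univ_eq_zero.1 (hτ.trans h0)
      simp [this]
    · rw [ENNReal.inv_mul_cancel h0 (measure_ne_top ρ _), one_smul]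
  have hle : ∀ t : ℝ≥0∞, r⁻¹ * (r * t) ≤ t := by
    intro t
    rw [← mul_assoc]
    exact (mul_le_mul_left (ENNReal.inv_mul_le_one r) t).trans_eq (one_mul t)
  set π : Measure (M × M) := κ + r⁻¹ • ρ.prod σ with hπ
  have hπ1 : π.map Prod.fst = μ := by
    rw [hπ, Measure.map_add _ _ measurable_fst, Measure.map_smul, Measure.map_fst_prod, smul_smul,
      ← huu, hcancel ρ rfl, add_comm, hρs]
  have hπ2 : π.map Prod.snd = ν := by
    rw [hπ, Measure.map_add _ _ measurable_snd, Measure.map_smul, Measure.map_snd_prod, smul_smul,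
      hcancel σ huu.symm, add_comm, hσs]
  have hπp : IsProbabilityMeasure π := ⟨by
    have := congrArg (fun m : Measure M => m Set.univ) hπ1
    simpa [Measure.map_apply measurable_fst MeasurableSet.univ] using this⟩
  refine (iInf₂_le (⟨π, hπp⟩ : ProbabilityMeasure (M × M)) ⟨hπ1, hπ2⟩).trans ?_
  change ∫⁻ z, (c z.1 z.2 : ℝ≥0∞) ∂π ≤ _
  rw [hπ, lintegral_add_measure, lintegral_smul_measure]
  gcongr
  calc r⁻¹ • ∫⁻ z, (c z.1 z.2 : ℝ≥0∞) ∂ρ.prod σ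
      ≤ r⁻¹ • ∫⁻ z, ((f z.1 : ℝ≥0∞) + f z.2) ∂ρ.prod σ := by
        gcongr with z
        exact_mod_cast hcf z.1 z.2
    _ = r⁻¹ * (r * (∫⁻ x, (f x : ℝ≥0∞) ∂ρ + ∫⁻ x, (f x : ℝ≥0∞) ∂σ)) := by
        have e1 : ∫⁻ z, (f z.1 : ℝ≥0∞) ∂ρ.prod σ = r * ∫⁻ x, (f x : ℝ≥0∞) ∂ρ := by
          rw [← lintegral_map (f := fun x => (f x : ℝ≥0∞)) (by fun_prop) measurable_fst,
            Measure.map_fst_prod, lintegral_smul_measure, ← huu, smul_eq_mul]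
        have e2 : ∫⁻ z, (f z.2 : ℝ≥0∞) ∂ρ.prod σ = r * ∫⁻ x, (f x : ℝ≥0∞) ∂σ := by
          rw [← lintegral_map (f := fun x => (f x : ℝ≥0∞)) (by fun_prop) measurable_snd,
            Measure.map_snd_prod, lintegral_smul_measure, smul_eq_mul]
        rw [lintegral_add_left (by fun_prop), e1, e2, smul_eq_mul, ← mul_add r]
    _ ≤ _ := hle _

/-- Split `f ≤ R + (f - R)⁺`. The bound is uniform over submeasures `ρ` of `μ` of given mass, as
needed for the leftovers. -/
theorem lintegral_le_mul_add_lintegral_tsub {M : Type*} [MeasurableSpace M] {ρ μ : Measure M}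
    (h : ρ ≤ μ) {f : M → ℝ≥0} (R : ℝ≥0) :
    ∫⁻ x, (f x : ℝ≥0∞) ∂ρ ≤ R * ρ Set.univ + ∫⁻ x, ((f x - R : ℝ≥0) : ℝ≥0∞) ∂μ := by
  calc ∫⁻ x, (f x : ℝ≥0∞) ∂ρ ≤ ∫⁻ x, ((R : ℝ≥0∞) + ((f x - R : ℝ≥0) : ℝ≥0∞)) ∂ρ := by
        gcongr with x
        exact_mod_cast le_add_tsub
    _ = R * ρ Set.univ + ∫⁻ x, ((f x - R : ℝ≥0) : ℝ≥0∞) ∂ρ := by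
        rw [lintegral_add_left measurable_const, lintegral_const]
    _ ≤ _ := by gcongr

theorem tendsto_lintegral_tsub_atTop {M : Type*} [MeasurableSpace M] {μ : Measure M}
    {f : M → ℝ≥0} (hf : Measurable f) (hfin : ∫⁻ x, (f x : ℝ≥0∞) ∂μ ≠ ∞) :
    Tendsto (fun k : ℕ => ∫⁻ x, ((f x - (k : ℝ≥0) : ℝ≥0) : ℝ≥0∞) ∂μ) atTop (𝓝 0) := by
  rw [← lintegral_zero (μ := μ)]
  refine tendsto_lintegral_of_dominated_convergence (fun x => (f x : ℝ≥0∞))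
    (fun k => by fun_prop) (fun k => ae_of_all _ fun x => ?_) hfin (ae_of_all _ fun x => ?_)
  · exact ENNReal.coe_le_coe.2 tsub_le_self
  · obtain ⟨k, hk⟩ := exists_nat_ge (f x)
    refine tendsto_const_nhds.congr' ?_
    filter_upwards [eventually_ge_atTop k] with m hm
    rw [tsub_eq_zero_of_le (hk.trans (by exact_mod_cast hm)), ENNReal.coe_zero]

/-- Here convergence of moments turns into uniform control of tails: `(f - R)⁺ = f - min f R`, and
`min f R` is bounded and continuous. -/
theorem tendsto_lintegral_tsub_of_tendsto {M : Type*} [MeasurableSpace M] [TopologicalSpace M]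
    [OpensMeasurableSpace M] {μs : ℕ → ProbabilityMeasure M} {μ : ProbabilityMeasure M}
    (hμ : Tendsto μs atTop (𝓝 μ)) {f : M → ℝ≥0} (hf : Continuous f)
    (hlim : Tendsto (fun n => ∫⁻ x, (f x : ℝ≥0∞) ∂(μs n : Measure M)) atTop
      (𝓝 (∫⁻ x, (f x : ℝ≥0∞) ∂(μ : Measure M))))
    (hfin : ∫⁻ x, (f x : ℝ≥0∞) ∂(μ : Measure M) ≠ ∞) (R : ℝ≥0) :
    Tendsto (fun n => ∫⁻ x, ((f x - R : ℝ≥0) : ℝ≥0∞) ∂(μs n : Measure M)) atTop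
      (𝓝 (∫⁻ x, ((f x - R : ℝ≥0) : ℝ≥0∞) ∂(μ : Measure M))) := by
  have hm : Measurable f := hf.measurable
  have hmin : Tendsto (fun n => ∫⁻ x, ((min (f x) R : ℝ≥0) : ℝ≥0∞) ∂(μs n : Measure M)) atTop
      (𝓝 (∫⁻ x, ((min (f x) R : ℝ≥0) : ℝ≥0∞) ∂(μ : Measure M))) := by
    refine ProbabilityMeasure.tendsto_iff_forall_lintegral_tendsto.1 hμ
      (BoundedContinuousFunction.mkOfBound ⟨fun x => min (f x) R, by fun_prop⟩ R fun x y => ?_)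
    change dist (min (f x) R) (min (f y) R) ≤ R
    rw [NNReal.dist_eq, abs_le]
    have h1 : ((min (f x) R : ℝ≥0) : ℝ) ≤ R := by exact_mod_cast min_le_right _ _
    have h2 : ((min (f y) R : ℝ≥0) : ℝ) ≤ R := by exact_mod_cast min_le_right _ _
    have h3 := (min (f x) R).2
    have h4 := (min (f y) R).2
    constructor <;> linarith
  have hminfin : ∀ ν : ProbabilityMeasure M,
      ∫⁻ x, ((min (f x) R : ℝ≥0) : ℝ≥0∞) ∂(ν : Measure M) ≠ ∞ := by
    intro ν
    refine ne_top_of_le_ne_top (ENNReal.coe_ne_top (r := R)) ?_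
    calc _ ≤ ∫⁻ _, (R : ℝ≥0∞) ∂(ν : Measure M) := by
          gcongr with x
          exact min_le_right _ _
      _ = R := by simp
  have key : ∀ ν : ProbabilityMeasure M, ∫⁻ x, ((f x - R : ℝ≥0) : ℝ≥0∞) ∂(ν : Measure M) =
      ∫⁻ x, (f x : ℝ≥0∞) ∂(ν : Measure M) -
        ∫⁻ x, ((min (f x) R : ℝ≥0) : ℝ≥0∞) ∂(ν : Measure M) := by
    intro ν
    refine ENNReal.eq_sub_of_add_eq (hminfin ν) ?_
    rw [← lintegral_add_right _ (by fun_prop)]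
    congr with x
    norm_cast
    exact tsub_add_min
  simp_rw [key]
  exact ENNReal.Tendsto.sub hlim hmin (Or.inl hfin)

/-! ### Small cells with null boundary and the coupling inside them -/

/-- Balls around a dense sequence are made disjoint; null boundaries survive complements and finite
intersections. -/
theorem exists_finite_partition_null_frontier {M : Type*} [MetricSpace M]
    [TopologicalSpace.SeparableSpace M] [MeasurableSpace M] [BorelSpace M]
    (μ : ProbabilityMeasure M) {δ : ℝ} (hδ : 0 < δ) {η : ℝ≥0∞} (hη : η ≠ 0) :
    ∃ (N : ℕ) (A : ℕ → Set M), (∀ i, MeasurableSet (A i)) ∧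
      Pairwise (Function.onFun Disjoint A) ∧
      (∀ i, (μ : Measure M) (frontier (A i)) = 0) ∧ (∀ i, ∀ x ∈ A i, ∀ y ∈ A i, dist x y ≤ δ) ∧
      1 < ∑ i ∈ Finset.range N, (μ : Measure M) (A i) + η := by
  obtain ⟨x₀⟩ : Nonempty M := nonempty_of_isProbabilityMeasure (μ : Measure M)
  let u : ℕ → M := @TopologicalSpace.denseSeq M _ _ ⟨x₀⟩
  have hu : DenseRange u := @TopologicalSpace.denseRange_denseSeq M _ _ ⟨x₀⟩
  -- Radii above `δ / 4` make the balls cover `M`; radii below `δ / 2` keep the diameters at most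
  -- `δ`.
  choose r hr hrμ using fun i => exists_null_frontier_thickening (μ : Measure M) {u i}
    (show δ / 4 < δ / 2 by linarith)
  simp_rw [Metric.thickening_singleton] at hrμ
  let b : ℕ → Set M := fun i => Metric.ball (u i) (r i)
  have hbA : ∀ i, disjointed b i ⊆ b i := disjointed_subset b
  have hm : ∀ i, MeasurableSet (disjointed b i) :=
    MeasurableSet.disjointed fun i => Metric.isOpen_ball.measurableSet
  have hfinter : ∀ s t : Set M, (μ : Measure M) (frontier s) = 0 → (μ : Measure M) (frontier t) = 0
      → (μ : Measure M) (frontier (s ∩ t)) = 0 := by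
    intro s t hs ht
    refine measure_mono_null ((frontier_inter_subset s t).trans ?_) (measure_union_null hs ht)
    exact Set.union_subset_union Set.inter_subset_left Set.inter_subset_right
  have hunion : ⋃ i, disjointed b i = Set.univ := by
    rw [iUnion_disjointed]
    refine Set.eq_univ_of_forall fun x => ?_
    obtain ⟨i, hi⟩ := hu.exists_dist_lt x (show (0 : ℝ) < δ / 4 by positivity)
    exact Set.mem_iUnion.2 ⟨i, Metric.mem_ball.2 (hi.trans (hr i).1)⟩
  have hsum : HasSum (fun i => (μ : Measure M) (disjointed b i)) 1 := by
    have := measure_iUnion (μ := (μ : Measure M)) (disjoint_disjointed b) hm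
    rw [hunion, measure_univ] at this
    rw [this]
    exact ENNReal.summable.hasSum
  obtain ⟨N, hN⟩ := ((hsum.tendsto_sum_nat.add_const η).eventually_const_lt
    (show (1 : ℝ≥0∞) < 1 + η from ENNReal.lt_add_right ENNReal.one_ne_top hη)).exists
  refine ⟨N, disjointed b, hm, disjoint_disjointed b, fun i => ?_, fun i x hx y hy => ?_, hN⟩
  · refine disjointedRec (p := fun s => (μ : Measure M) (frontier s) = 0) (fun {t j} ht => ?_)
      (hrμ i)
    rw [Set.sdiff_eq]
    exact hfinter _ _ ht (by rw [frontier_compl]; exact hrμ j)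
  · have h1 := Metric.mem_ball.1 (hbA i hx)
    have h2 := Metric.mem_ball.1 (hbA i hy)
    have h3 := (hr i).2
    have := dist_triangle_right x y (u i)
    linarith

/-- The coupling of parts of `μ` and `ν` which moves mass only within the first `N` sets `A i`. -/
noncomputable def blockCoupling {M : Type*} [MeasurableSpace M] (μ ν : Measure M) (A : ℕ → Set M)
    (N : ℕ) : Measure (M × M) :=
  ∑ i ∈ Finset.range N, (max (μ (A i)) (ν (A i)))⁻¹ • (μ.restrict (A i)).prod (ν.restrict (A i))

section blockCoupling

variable {M : Type*} [MeasurableSpace M] {μ ν : Measure M} {A : ℕ → Set M} {N : ℕ}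

theorem sum_restrict_le (hA : ∀ i, MeasurableSet (A i)) (hd : Pairwise (Function.onFun Disjoint A)) :
    ∑ i ∈ Finset.range N, μ.restrict (A i) ≤ μ := by
  refine Measure.le_iff.2 fun s hs => ?_
  rw [Measure.finsetSum_apply]
  simp_rw [Measure.restrict_apply hs]
  rw [← measure_biUnion_finset (fun i _ j _ hij => (hd hij).mono Set.inter_subset_right
    Set.inter_subset_right) fun i _ => hs.inter (hA i)]
  exact measure_mono (Set.iUnion₂_subset fun i _ => Set.inter_subset_left)

theorem blockCoupling_fst_le [SFinite ν] (hA : ∀ i, MeasurableSet (A i))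
    (hd : Pairwise (Function.onFun Disjoint A)) : (blockCoupling μ ν A N).map Prod.fst ≤ μ := by
  refine le_trans ?_ (sum_restrict_le (N := N) hA hd)
  rw [blockCoupling, ← Measure.mapₗ_apply_of_measurable measurable_fst, map_sum]
  refine Finset.sum_le_sum fun i _ => ?_
  rw [Measure.mapₗ_apply_of_measurable measurable_fst, Measure.map_smul, Measure.map_fst_prod,
    smul_smul, Measure.restrict_apply_univ]
  have : (max (μ (A i)) (ν (A i)))⁻¹ * ν (A i) ≤ 1 :=
    (mul_le_mul_right (le_max_right _ _) _).trans (ENNReal.inv_mul_le_one _)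
  intro s
  simpa using mul_le_mul_left this (μ.restrict (A i) s)

theorem blockCoupling_snd_le [SFinite ν] (hA : ∀ i, MeasurableSet (A i))
    (hd : Pairwise (Function.onFun Disjoint A)) : (blockCoupling μ ν A N).map Prod.snd ≤ ν := by
  refine le_trans ?_ (sum_restrict_le (N := N) hA hd)
  rw [blockCoupling, ← Measure.mapₗ_apply_of_measurable measurable_snd, map_sum]
  refine Finset.sum_le_sum fun i _ => ?_
  rw [Measure.mapₗ_apply_of_measurable measurable_snd, Measure.map_smul, Measure.map_snd_prod,
    smul_smul, Measure.restrict_apply_univ]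
  have : (max (μ (A i)) (ν (A i)))⁻¹ * μ (A i) ≤ 1 :=
    (mul_le_mul_right (le_max_left _ _) _).trans (ENNReal.inv_mul_le_one _)
  intro s
  simpa using mul_le_mul_left this (ν.restrict (A i) s)

/-- Since a product is max times min, dividing by the max leaves exactly the common mass of each
cell. -/
theorem blockCoupling_univ [IsFiniteMeasure μ] [IsFiniteMeasure ν] :
    blockCoupling μ ν A N Set.univ = ∑ i ∈ Finset.range N, min (μ (A i)) (ν (A i)) := by
  rw [blockCoupling, Measure.finsetSum_apply]
  refine Finset.sum_congr rfl fun i _ => ?_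
  rw [Measure.smul_apply, ← Set.univ_prod_univ, Measure.prod_prod, Measure.restrict_apply_univ,
    Measure.restrict_apply_univ, smul_eq_mul, ← max_mul_min (μ (A i)), ← mul_assoc]
  rcases eq_or_ne (max (μ (A i)) (ν (A i))) 0 with h | h
  · have : min (μ (A i)) (ν (A i)) = 0 := le_antisymm (min_le_max.trans_eq h) zero_le
    simp [this]
  · rw [ENNReal.inv_mul_cancel h (max_lt (measure_lt_top _ _) (measure_lt_top _ _)).ne, one_mul]

theorem lintegral_blockCoupling_le [SFinite μ] [SFinite ν] (hA : ∀ i, MeasurableSet (A i))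
    {g : M × M → ℝ≥0∞}
    (t : ℝ≥0∞) (hg : ∀ i, ∀ x ∈ A i, ∀ y ∈ A i, g (x, y) ≤ t) :
    ∫⁻ z, g z ∂(blockCoupling μ ν A N) ≤ t * blockCoupling μ ν A N Set.univ := by
  rw [blockCoupling, lintegral_finsetSum_measure, Measure.finsetSum_apply, Finset.mul_sum]
  refine Finset.sum_le_sum fun i _ => ?_
  rw [← lintegral_const]
  refine lintegral_mono_ae (Measure.ae_smul_measure ?_ _)
  rw [Measure.prod_restrict]
  filter_upwards [ae_restrict_mem ((hA i).prod (hA i))] with z hz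
  exact hg i _ hz.1 _ hz.2

end blockCoupling

/-! ### Consequences of doubling, and integrals under couplings -/

theorem Doubling.map_add_le {C : ℝ≥0 → ℝ≥0} {Λ : ℝ≥0} (hmono : Monotone C)
    (hΛ : ∀ y, C (2 * y) ≤ Λ * C y) (s t : ℝ≥0) : C (s + t) ≤ Λ * C s + Λ * C t := by
  rcases le_total s t with h | h
  · calc C (s + t) ≤ C (2 * t) := hmono (by rw [two_mul]; gcongr)
      _ ≤ Λ * C t := hΛ t
      _ ≤ _ := le_add_self
  · calc C (s + t) ≤ C (2 * s) := hmono (by rw [two_mul]; gcongr)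
      _ ≤ Λ * C s := hΛ s
      _ ≤ _ := le_self_add

/-- A zero at `s > 0` spreads to every `2 ^ k * s`, hence everywhere by monotonicity. This permits
division by `C δ` below. -/
theorem Doubling.pos {C : ℝ≥0 → ℝ≥0} (hC : Doubling C) (hmono : Monotone C)
    (hne : ∃ t, C t ≠ 0) {s : ℝ≥0} (hs : 0 < s) : 0 < C s := by
  obtain ⟨Λ, -, hΛ⟩ := hC
  obtain ⟨t, ht⟩ := hne
  by_contra h0
  replace h0 : C s = 0 := le_antisymm (not_lt.1 h0) zero_le
  have hk : ∀ k : ℕ, C (2 ^ k * s) = 0 := by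
    intro k
    induction k with
    | zero => simpa using h0
    | succ k ih =>
      refine le_antisymm ?_ zero_le
      rw [pow_succ', mul_assoc]
      exact (hΛ _).trans_eq (by rw [ih, mul_zero])
  obtain ⟨k, hk'⟩ := pow_unbounded_of_one_lt (t / s) (one_lt_two (α := ℝ≥0))
  refine ht (le_antisymm ?_ zero_le)
  rw [← hk k]
  exact hmono ((div_le_iff₀ hs).1 hk'.le)

theorem lintegral_fst_of_isCoupling {M : Type*} [MeasurableSpace M]
    {π : ProbabilityMeasure (M × M)} {μ ν : ProbabilityMeasure M}
    (h : IsCoupling π μ ν) {f : M → ℝ≥0∞} (hf : Measurable f) :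
    ∫⁻ z, f z.1 ∂(π : Measure (M × M)) = ∫⁻ x, f x ∂(μ : Measure M) := by
  rw [← h.1, lintegral_map hf measurable_fst]

theorem lintegral_snd_of_isCoupling {M : Type*} [MeasurableSpace M]
    {π : ProbabilityMeasure (M × M)} {μ ν : ProbabilityMeasure M}
    (h : IsCoupling π μ ν) {f : M → ℝ≥0∞} (hf : Measurable f) :
    ∫⁻ z, f z.2 ∂(π : Measure (M × M)) = ∫⁻ x, f x ∂(ν : Measure M) := by
  rw [← h.2, lintegral_map hf measurable_snd]

/-! ### From weak convergence and moments to transportation distance -/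

section

variable {M : Type*} [MetricSpace M] [TopologicalSpace.SeparableSpace M] [MeasurableSpace M]
  [BorelSpace M] {C : ℝ≥0 → ℝ≥0} {μs : ℕ → ProbabilityMeasure M} {μ : ProbabilityMeasure M}

theorem measurable_cost (hcont : Continuous C) :
    Measurable fun z : M × M => C (nndist z.1 z.2) :=
  hcont.measurable.comp measurable_nndist

/-- Weak convergence together with convergence of the moments implies convergence of the
transportation distance. -/
theorem tendsto_transportDist (hmono : Monotone C) (hcont : Continuous C) (h0 : C 0 = 0)
    (hC : Doubling C) (a : M) (hfin : ∫⁻ x, (C (nndist x a) : ℝ≥0∞) ∂(μ : Measure M) ≠ ∞)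
    (hμ : Tendsto μs atTop (𝓝 μ))
    (hlim : Tendsto (fun n => ∫⁻ x, (C (nndist x a) : ℝ≥0∞) ∂(μs n : Measure M)) atTop
      (𝓝 (∫⁻ x, (C (nndist x a) : ℝ≥0∞) ∂(μ : Measure M)))) :
    Tendsto (fun n => transportDist (fun x y => C (nndist x y)) (μs n) μ) atTop (𝓝 0) := by
  obtain ⟨Λ, hΛ0, hΛ⟩ := hC
  set f : M → ℝ≥0 := fun x => Λ * C (nndist x a) with hf
  have hfc : Continuous f := by fun_prop
  have hcf : ∀ x y : M, C (nndist x y) ≤ f x + f y := fun x y =>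
    (hmono (nndist_triangle_right x y a)).trans (Doubling.map_add_le hmono hΛ _ _)
  have hfint : ∀ ν : ProbabilityMeasure M, ∫⁻ x, (f x : ℝ≥0∞) ∂(ν : Measure M) =
      Λ * ∫⁻ x, (C (nndist x a) : ℝ≥0∞) ∂(ν : Measure M) := by
    intro ν
    rw [← lintegral_const_mul' _ _ ENNReal.coe_ne_top]
    simp [hf]
  have hffin : ∫⁻ x, (f x : ℝ≥0∞) ∂(μ : Measure M) ≠ ∞ := by
    rw [hfint]; exact ENNReal.mul_ne_top ENNReal.coe_ne_top hfin
  have hflim : Tendsto (fun n => ∫⁻ x, (f x : ℝ≥0∞) ∂(μs n : Measure M)) atTop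
      (𝓝 (∫⁻ x, (f x : ℝ≥0∞) ∂(μ : Measure M))) := by
    simp_rw [hfint]
    exact ENNReal.Tendsto.const_mul hlim (Or.inr ENNReal.coe_ne_top)
  rw [ENNReal.tendsto_nhds_zero]
  intro ε hε
  -- split `ε` into five parts
  obtain ⟨η, hη0, hηε⟩ : ∃ η : ℝ≥0, 0 < η ∧ (5 * η : ℝ≥0∞) ≤ ε := by
    obtain ⟨θ, hθ0, hθ⟩ := ENNReal.lt_iff_exists_nnreal_btwn.1 hε
    refine ⟨θ / 5, div_pos (by exact_mod_cast hθ0) (by norm_num), le_trans (le_of_eq ?_) hθ.le⟩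
    have : (5 : ℝ≥0) * (θ / 5) = θ := mul_div_cancel₀ _ (by norm_num)
    exact_mod_cast congrArg ((↑) : ℝ≥0 → ℝ≥0∞) this
  have hη0' : (0 : ℝ≥0∞) < η := by exact_mod_cast hη0
  obtain ⟨δ, hδ0, hδ⟩ : ∃ δ : ℝ≥0, 0 < δ ∧ C δ ≤ η := by
    have h1 : ∀ᶠ s in 𝓝 (0 : ℝ≥0), C s < η :=
      hcont.continuousAt.eventually_lt_const (by rwa [h0])
    have h2 : ∀ᶠ s in 𝓝[>] (0 : ℝ≥0), C s < η := h1.filter_mono nhdsWithin_le_nhds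
    obtain ⟨s, hs1, hs2⟩ := (h2.and self_mem_nhdsWithin).exists
    exact ⟨s, hs2, hs1.le⟩
  obtain ⟨k, hk⟩ := ((tendsto_lintegral_tsub_atTop hfc.measurable hffin).eventually_lt_const
    hη0').exists
  set R : ℝ≥0 := (k : ℝ≥0) with hR
  have hk' := (tendsto_lintegral_tsub_of_tendsto hμ hfc hflim hffin R).eventually_lt_const hk
  -- The uncovered mass must stay small even after multiplication by `R`; the `+ 1` allows `R = 0`.
  obtain ⟨N, A, hA, hd, hfr, hdiam, hmass⟩ := exists_finite_partition_null_frontier μ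
    (δ := δ) (by exact_mod_cast hδ0) (η := (η / (R + 1) : ℝ≥0))
    (by exact_mod_cast (div_pos hη0 (by positivity)).ne')
  set θ : ℝ≥0 := η / (R + 1) with hθ
  have hRθ : (R : ℝ≥0∞) * θ ≤ η := by
    have : R * θ ≤ η := by
      rw [hθ, ← mul_div_assoc, div_le_iff₀ (by positivity), mul_comm]
      gcongr
      exact le_self_add
    exact_mod_cast this
  have hblock : Tendsto (fun n => ∑ i ∈ Finset.range N,
      min ((μs n : Measure M) (A i)) ((μ : Measure M) (A i)) + θ) atTop
      (𝓝 (∑ i ∈ Finset.range N, (μ : Measure M) (A i) + θ)) := by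
    refine Tendsto.add_const _ (tendsto_finsetSum _ fun i _ => ?_)
    have h1 := ProbabilityMeasure.tendsto_measure_of_null_frontier_of_tendsto' hμ (hfr i)
    simpa using h1.min (tendsto_const_nhds (x := (μ : Measure M) (A i)))
  filter_upwards [hk', hblock.eventually_const_lt hmass] with n hn1 hn2
  set κ := blockCoupling (μs n : Measure M) (μ : Measure M) A N with hκ
  have h₁ : κ.map Prod.fst ≤ μs n := blockCoupling_fst_le hA hd
  have h₂ : κ.map Prod.snd ≤ μ := blockCoupling_snd_le hA hd
  rw [← blockCoupling_univ, ← hκ] at hn2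
  have hfst : κ.map Prod.fst Set.univ = κ Set.univ := by
    rw [Measure.map_apply measurable_fst MeasurableSet.univ, Set.preimage_univ]
  have hsnd : κ.map Prod.snd Set.univ = κ Set.univ := by
    rw [Measure.map_apply measurable_snd MeasurableSet.univ, Set.preimage_univ]
  have hκ1 : κ Set.univ ≤ 1 := by
    rw [← hfst]; exact (h₁ Set.univ).trans_eq measure_univ
  have : IsFiniteMeasure κ := ⟨hκ1.trans_lt ENNReal.one_lt_top⟩
  have hrest : ∀ (ν : ProbabilityMeasure M) (τ : Measure M), τ ≤ ν → τ Set.univ = κ Set.univ →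
      ∫⁻ x, ((f x - R : ℝ≥0) : ℝ≥0∞) ∂(ν : Measure M) ≤ η →
      ∫⁻ x, (f x : ℝ≥0∞) ∂((ν : Measure M) - τ) ≤ η + η := by
    intro ν τ hτ hτu hν
    have : IsFiniteMeasure τ := ⟨by rw [hτu]; exact measure_lt_top _ _⟩
    refine (lintegral_le_mul_add_lintegral_tsub Measure.sub_le R).trans (add_le_add ?_ hν)
    refine le_trans ?_ hRθ
    gcongr
    rw [Measure.sub_apply MeasurableSet.univ hτ, hτu, measure_univ]
    exact tsub_le_iff_left.2 hn2.le
  calc transportDist (fun x y => C (nndist x y)) (μs n) μ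
      ≤ ∫⁻ z, (C (nndist z.1 z.2) : ℝ≥0∞) ∂κ +
        (∫⁻ x, (f x : ℝ≥0∞) ∂((μs n : Measure M) - κ.map Prod.fst) +
          ∫⁻ x, (f x : ℝ≥0∞) ∂((μ : Measure M) - κ.map Prod.snd)) :=
        transportDist_le_of_marginals_le hfc.measurable hcf h₁ h₂
    -- One `η` for transport inside cells; each leftover pays one for its part below `R` and one for
    -- its tail.
    _ ≤ η + ((η + η) + (η + η)) := by
        gcongr
        · refine (lintegral_blockCoupling_le hA (η : ℝ≥0∞) fun i x hx y hy => ?_).trans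
            ((mul_le_mul_right hκ1 _).trans_eq (mul_one _))
          exact ENNReal.coe_le_coe.2 ((hmono (by exact_mod_cast hdiam i x hx y hy)).trans hδ)
        · exact hrest _ _ h₁ hfst hn1.le
        · exact hrest _ _ h₂ hsnd hk.le
    _ = 5 * η := by ring
    _ ≤ ε := hηε

/-! ### From transportation distance to weak convergence and moments -/

/-- If the integral of `g` can be compared with that of `h`, under couplings, up to a small error,
a multiple of the cost and a small integral, then the integrals converge. -/
theorem tendsto_lintegral_of_le_add_cost (hcont : Continuous C)
    (hT : Tendsto (fun n => transportDist (fun x y => C (nndist x y)) (μs n) μ) atTop (𝓝 0))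
    {g : M → ℝ≥0} (hg : Measurable g) (hfin : ∫⁻ x, (g x : ℝ≥0∞) ∂(μ : Measure M) ≠ ∞)
    (hle : ∀ ε : ℝ≥0, 0 < ε → ∃ (K : ℝ≥0) (e : M → ℝ≥0), Measurable e ∧
      ∫⁻ x, (e x : ℝ≥0∞) ∂(μ : Measure M) ≤ ε ∧
      ∀ x y, g x ≤ g y + (e y + K * C (nndist x y)) ∧
        g y ≤ g x + (e y + K * C (nndist x y))) :
    Tendsto (fun n => ∫⁻ x, (g x : ℝ≥0∞) ∂(μs n : Measure M)) atTop
      (𝓝 (∫⁻ x, (g x : ℝ≥0∞) ∂(μ : Measure M))) := by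
  rw [ENNReal.tendsto_nhds hfin]
  intro ε hε
  obtain ⟨η, hη0, hηε⟩ : ∃ η : ℝ≥0, 0 < η ∧ (2 * η : ℝ≥0∞) ≤ ε := by
    obtain ⟨θ, hθ0, hθ⟩ := ENNReal.lt_iff_exists_nnreal_btwn.1 hε
    refine ⟨θ / 2, div_pos (by exact_mod_cast hθ0) (by norm_num), le_trans (le_of_eq ?_) hθ.le⟩
    have : (2 : ℝ≥0) * (θ / 2) = θ := mul_div_cancel₀ _ (by norm_num)
    exact_mod_cast congrArg ((↑) : ℝ≥0 → ℝ≥0∞) this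
  obtain ⟨K, e, he, heη, hK⟩ := hle η hη0
  have hθ : (0 : ℝ≥0∞) < (η / (K + 1) : ℝ≥0) := by
    exact_mod_cast div_pos hη0 (by positivity)
  filter_upwards [hT.eventually_lt_const hθ] with n hn
  simp only [transportDist, iInf_lt_iff] at hn
  obtain ⟨π, hπ, hcost⟩ := hn
  have hc := measurable_cost (M := M) hcont
  have herr : ∫⁻ z, ((e z.2 : ℝ≥0∞) + K * C (nndist z.1 z.2)) ∂(π : Measure (M × M)) ≤ ε := by
    rw [lintegral_add_left (by fun_prop), lintegral_const_mul' _ _ ENNReal.coe_ne_top,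
      lintegral_snd_of_isCoupling hπ (f := fun y => (e y : ℝ≥0∞)) (by fun_prop)]
    refine le_trans ?_ hηε
    rw [two_mul]
    refine add_le_add heη ((mul_le_mul_right hcost.le _).trans ?_)
    have : K * (η / (K + 1)) ≤ η := by
      rw [← mul_div_assoc, div_le_iff₀ (by positivity), mul_comm]
      gcongr
      exact le_self_add
    exact_mod_cast this
  rw [← lintegral_fst_of_isCoupling hπ (f := fun x => (g x : ℝ≥0∞)) (by fun_prop),
    ← lintegral_snd_of_isCoupling hπ (f := fun x => (g x : ℝ≥0∞)) (by fun_prop)]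
  constructor
  · refine tsub_le_iff_right.2 (le_trans ?_ (add_le_add le_rfl herr))
    rw [← lintegral_add_left (by fun_prop)]
    refine lintegral_mono fun z => ?_
    rw [← ENNReal.coe_mul, ← ENNReal.coe_add, ← ENNReal.coe_add]
    exact ENNReal.coe_le_coe.2 (hK z.1 z.2).2
  · refine le_trans ?_ (add_le_add le_rfl herr)
    rw [← lintegral_add_left (by fun_prop)]
    refine lintegral_mono fun z => ?_
    rw [← ENNReal.coe_mul, ← ENNReal.coe_add, ← ENNReal.coe_add]
    exact ENNReal.coe_le_coe.2 (hK z.1 z.2).1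

/-- Test on bounded Lipschitz functions: at distance at most `δ` the Lipschitz bound is enough, and
beyond it the oscillation `B` is at most `(B / C δ) * C (d(x, y))`. -/
theorem tendsto_of_tendsto_transportDist (hmono : Monotone C) (hcont : Continuous C)
    (hpos : ∀ s, 0 < s → 0 < C s)
    (hT : Tendsto (fun n => transportDist (fun x y => C (nndist x y)) (μs n) μ) atTop (𝓝 0)) :
    Tendsto μs atTop (𝓝 μ) := by
  refine tendsto_iff_forall_lipschitz_integral_tendsto.2 ?_
  rintro f ⟨B, hB⟩ ⟨L, hL⟩
  obtain ⟨x₀⟩ : Nonempty M := nonempty_of_isProbabilityMeasure (μ : Measure M)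
  lift B to ℝ≥0 using dist_nonneg.trans (hB x₀ x₀)
  -- A constant shift makes `f` nonnegative, so that lower integrals apply.
  have hf0 : ∀ x, 0 ≤ f x + (B - f x₀) := fun x => by
    have := (abs_le.1 ((Real.dist_eq _ _).symm.trans_le (hB x x₀))).1
    linarith
  have hf1 : ∀ x, f x + (B - f x₀) ≤ 2 * B := fun x => by
    have := (abs_le.1 ((Real.dist_eq _ _).symm.trans_le (hB x x₀))).2
    linarith
  set g : M → ℝ≥0 := fun x => ⟨f x + (B - f x₀), hf0 x⟩ with hg
  have hgc : Continuous g := (hL.continuous.add continuous_const).subtype_mk _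
  have hgm := hgc.measurable
  have hgfin : ∀ ν : ProbabilityMeasure M, ∫⁻ x, (g x : ℝ≥0∞) ∂(ν : Measure M) ≠ ∞ := by
    intro ν
    refine ne_top_of_le_ne_top (ENNReal.ofReal_ne_top (r := 2 * B)) ?_
    calc ∫⁻ x, (g x : ℝ≥0∞) ∂(ν : Measure M)
        ≤ ∫⁻ _, ENNReal.ofReal (2 * B) ∂(ν : Measure M) := by
          refine lintegral_mono fun x => ?_
          rw [← ENNReal.ofReal_coe_nnreal]
          exact ENNReal.ofReal_le_ofReal (hf1 x)
      _ = _ := by simp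
  have hint : ∀ ν : ProbabilityMeasure M, ∫ x, f x ∂(ν : Measure M) =
      (∫⁻ x, (g x : ℝ≥0∞) ∂(ν : Measure M)).toReal - (B - f x₀) := by
    intro ν
    have h1 : ∫ x, (g x : ℝ) ∂(ν : Measure M) =
        (∫⁻ x, (g x : ℝ≥0∞) ∂(ν : Measure M)).toReal :=
      integral_toReal (f := fun x => (g x : ℝ≥0∞)) (by fun_prop)
        (ae_of_all _ fun x => ENNReal.coe_lt_top)
    have h2 : Integrable (fun x => (g x : ℝ)) (ν : Measure M) :=
      integrable_toReal_of_lintegral_ne_top (f := fun x => (g x : ℝ≥0∞)) (by fun_prop) (hgfin ν)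
    have h3 : f = fun x => (g x : ℝ) - (B - f x₀) := by
      ext x
      change f x = f x + (B - f x₀) - (B - f x₀)
      ring
    rw [← h1]
    conv_lhs => rw [h3]
    rw [integral_sub h2 (integrable_const _)]
    simp
  simp_rw [hint]
  refine Tendsto.sub_const ((ENNReal.tendsto_toReal (hgfin μ)).comp ?_) _
  refine tendsto_lintegral_of_le_add_cost hcont hT hgm (hgfin μ) fun ε hε => ?_
  set δ : ℝ≥0 := ε / (L + 1) with hδ
  have hδ0 : 0 < δ := div_pos hε (by positivity)
  have hLδ : L * δ ≤ ε := by
    rw [hδ, ← mul_div_assoc, div_le_iff₀ (by positivity), mul_comm]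
    gcongr
    exact le_self_add
  refine ⟨B / C δ, fun _ => ε, measurable_const, by simp, fun x y => ?_⟩
  have key : dist (f x) (f y) ≤ (ε + (B / C δ) * C (nndist x y) : ℝ≥0) := by
    rcases le_total (nndist x y) δ with h | h
    · have h1 : nndist (f x) (f y) ≤ ε + (B / C δ) * C (nndist x y) :=
        ((hL.nndist_le x y).trans ((mul_le_mul_right h _).trans hLδ)).trans le_self_add
      exact_mod_cast h1
    · refine (hB x y).trans ?_
      have h1 : B ≤ ε + (B / C δ) * C (nndist x y) := by
        refine le_trans ?_ le_add_self
        rw [div_mul_eq_mul_div, le_div_iff₀ (hpos _ hδ0)]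
        gcongr
        exact hmono h
      exact_mod_cast h1
  rw [Real.dist_eq, abs_le] at key
  constructor
  · change f x + (B - f x₀) ≤ f y + (B - f x₀) + (ε + (B / C δ) * C (nndist x y) : ℝ≥0)
    linarith [key.2]
  · change f y + (B - f x₀) ≤ f x + (B - f x₀) + (ε + (B / C δ) * C (nndist x y) : ℝ≥0)
    linarith [key.1]

theorem exists_lintegral_indicator_lt {f : M → ℝ≥0} (hf : Measurable f) (a : M)
    (hfin : ∫⁻ x, (f x : ℝ≥0∞) ∂(μ : Measure M) ≠ ∞) {ε : ℝ≥0∞} (hε : 0 < ε) :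
    ∃ R : ℝ≥0, ∫⁻ x, (({x | R < nndist x a}.indicator f x : ℝ≥0) : ℝ≥0∞) ∂(μ : Measure M) < ε := by
  have h : Tendsto (fun k : ℕ => ∫⁻ x,
      (({x | (k : ℝ≥0) < nndist x a}.indicator f x : ℝ≥0) : ℝ≥0∞) ∂(μ : Measure M)) atTop
      (𝓝 (∫⁻ _, 0 ∂(μ : Measure M))) := by
    refine tendsto_lintegral_of_dominated_convergence (fun x => (f x : ℝ≥0∞))
      (fun k => (hf.indicator (measurableSet_lt (by fun_prop) (by fun_prop))).coe_nnreal_ennreal)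
      (fun k => ae_of_all _ fun x => ?_) hfin (ae_of_all _ fun x => ?_)
    · exact ENNReal.coe_le_coe.2 (Set.indicator_le_self' (fun _ _ => zero_le) x)
    · obtain ⟨k, hk⟩ := exists_nat_ge (nndist x a)
      refine tendsto_const_nhds.congr' ?_
      filter_upwards [eventually_ge_atTop k] with m hm
      rw [Set.indicator_of_notMem, ENNReal.coe_zero]
      exact not_lt.2 (hk.trans (by exact_mod_cast hm))
  rw [lintegral_zero] at h
  obtain ⟨k, hk⟩ := (h.eventually_lt_const hε).exists
  exact ⟨k, hk⟩

/-- With `t ≤ R` and `δ ≤ 1`, both points lie in the compact interval `[0, R + 1]`. -/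
theorem exists_uniform_modulus (hcont : Continuous C) (R : ℝ≥0) {ε : ℝ≥0} (hε : 0 < ε) :
    ∃ δ : ℝ≥0, 0 < δ ∧ ∀ s t, t ≤ R → s ≤ t + δ → t ≤ s + δ → C s ≤ C t + ε ∧ C t ≤ C s + ε := by
  have hu := (isCompact_Icc (a := (0 : ℝ≥0)) (b := R + 1)).uniformContinuousOn_of_continuous
    hcont.continuousOn
  obtain ⟨δ, hδ0, hδ⟩ := Metric.uniformContinuousOn_iff_le.1 hu ε (by exact_mod_cast hε)
  refine ⟨min 1 ⟨δ, hδ0.le⟩, lt_min one_pos hδ0, fun s t ht hs hts => ?_⟩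
  have hsR : s ≤ R + 1 := hs.trans (add_le_add ht (min_le_left _ _))
  have h1 : (s : ℝ) ≤ t + δ := by
    have : s ≤ t + ⟨δ, hδ0.le⟩ := hs.trans (add_le_add le_rfl (min_le_right _ _))
    exact_mod_cast this
  have h2 : (t : ℝ) ≤ s + δ := by
    have : t ≤ s + ⟨δ, hδ0.le⟩ := hts.trans (add_le_add le_rfl (min_le_right _ _))
    exact_mod_cast this
  have := hδ s ⟨zero_le, hsR⟩ t ⟨zero_le, ht.trans le_self_add⟩ (by
    rw [NNReal.dist_eq, abs_le]
    constructor <;> linarith)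
  rw [NNReal.dist_eq, abs_le] at this
  constructor
  · have h3 : (C s : ℝ) ≤ C t + ε := by linarith
    exact_mod_cast h3
  · have h3 : (C t : ℝ) ≤ C s + ε := by linarith
    exact_mod_cast h3

theorem tendsto_moment_of_tendsto_transportDist (hmono : Monotone C) (hcont : Continuous C)
    (hpos : ∀ s, 0 < s → 0 < C s) (hC : Doubling C) (a : M)
    (hfin : ∫⁻ x, (C (nndist x a) : ℝ≥0∞) ∂(μ : Measure M) ≠ ∞)
    (hT : Tendsto (fun n => transportDist (fun x y => C (nndist x y)) (μs n) μ) atTop (𝓝 0)) :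
    Tendsto (fun n => ∫⁻ x, (C (nndist x a) : ℝ≥0∞) ∂(μs n : Measure M)) atTop
      (𝓝 (∫⁻ x, (C (nndist x a) : ℝ≥0∞) ∂(μ : Measure M))) := by
  obtain ⟨Λ, -, hΛ⟩ := hC
  have hcm := hcont.measurable
  refine tendsto_lintegral_of_le_add_cost hcont hT (by fun_prop) hfin fun ε hε => ?_
  -- Far from `a`, the factor `Λ` serves the upper bound for `C (d(x, a))` and the `1` the bound for
  -- `C (d(y, a))`.
  set q : M → ℝ≥0 := fun x => (Λ + 1) * C (nndist x a) with hq
  have hqm : Measurable q := by fun_prop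
  have hqfin : ∫⁻ x, (q x : ℝ≥0∞) ∂(μ : Measure M) ≠ ∞ := by
    simp only [hq, ENNReal.coe_mul]
    rw [lintegral_const_mul' _ _ ENNReal.coe_ne_top]
    exact ENNReal.mul_ne_top ENNReal.coe_ne_top hfin
  have hε2 : 0 < ε / 2 := half_pos hε
  obtain ⟨R, hR⟩ := exists_lintegral_indicator_lt hqm a hqfin (ε := (ε / 2 : ℝ≥0))
    (by exact_mod_cast hε2)
  obtain ⟨δ, hδ0, hδ⟩ := exists_uniform_modulus hcont R hε2
  -- Cases: `y` far from `a` is paid by `q`; `y` near and `d(x, y) ≤ δ` by the modulus; otherwise `C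
  -- R ≤ (C R / C δ) * C (d(x, y))`. The constant sums the factors needed.
  refine ⟨Λ + Λ * (C R / C δ) + C R / C δ, fun y => ε / 2 + {x | R < nndist x a}.indicator q y,
    measurable_const.add (hqm.indicator (measurableSet_lt (by fun_prop) (by fun_prop))), ?_,
    fun x y => ?_⟩
  · simp only [ENNReal.coe_add]
    rw [lintegral_add_left measurable_const]
    refine (add_le_add le_rfl hR.le).trans_eq ?_
    rw [lintegral_const, measure_univ, mul_one, ← ENNReal.coe_add, add_halves]
  have hxy : nndist x a ≤ nndist y a + nndist x y := by
    rw [add_comm]; exact nndist_triangle x y a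
  have hyx : nndist y a ≤ nndist x a + nndist x y := by
    rw [add_comm, nndist_comm x y]; exact nndist_triangle y x a
  have hadd : C (nndist x a) ≤ Λ * C (nndist y a) + Λ * C (nndist x y) :=
    (hmono hxy).trans (Doubling.map_add_le hmono hΛ _ _)
  beta_reduce
  set P := C R / C δ
  set D := C (nndist x y)
  rcases lt_or_ge R (nndist y a) with h | h
  · rw [Set.indicator_of_mem (show y ∈ {x | R < nndist x a} from h)]
    constructor
    · calc C (nndist x a) ≤ Λ * C (nndist y a) + Λ * D := hadd
        _ ≤ (C (nndist y a) + (ε / 2 + Λ * C (nndist y a) + C (nndist y a))) +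
            (Λ + Λ * P + P) * D := by
          gcongr
          · rw [add_right_comm (ε / 2), ← add_assoc]
            exact le_add_self
          · rw [add_assoc]
            exact le_self_add
        _ = _ := by ring
    · calc C (nndist y a) ≤ C (nndist y a) +
            (C (nndist x a) + ε / 2 + Λ * C (nndist y a) + (Λ + Λ * P + P) * D) := le_self_add
        _ = _ := by ring
  · rw [Set.indicator_of_notMem (show y ∉ {x | R < nndist x a} from not_lt.2 h), add_zero]
    rcases le_total (nndist x y) δ with h' | h'
    · obtain ⟨h1, h2⟩ := hδ _ _ h (hxy.trans (by gcongr)) (hyx.trans (by gcongr))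
      rw [← add_assoc, ← add_assoc]
      exact ⟨h1.trans le_self_add, h2.trans le_self_add⟩
    · have hCR : C R ≤ P * D := by
        rw [div_mul_eq_mul_div, le_div_iff₀ (hpos _ hδ0)]
        gcongr
        exact hmono h'
      have hyR : C (nndist y a) ≤ P * D := (hmono h).trans hCR
      constructor
      · calc C (nndist x a) ≤ Λ * (P * D) + Λ * D := hadd.trans (by gcongr)
          _ ≤ Λ * (P * D) + Λ * D + (C (nndist y a) + ε / 2 + P * D) := le_self_add
          _ = _ := by ring
      · calc C (nndist y a) ≤ P * D := hyR
          _ ≤ P * D + (C (nndist x a) + ε / 2 + Λ * D + Λ * P * D) := le_self_add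
          _ = _ := by ring

end

/-! ### Finiteness of moments and the final criteria -/

theorem Doubling.lintegral_two_mul_lt_top_iff {M : Type*} [MetricSpace M] [MeasurableSpace M]
    {C : ℝ≥0 → ℝ≥0} (hmono : Monotone C) (hC : Doubling C) (ν : Measure M) (a : M) :
    ∫⁻ x, (C (2 * nndist x a) : ℝ≥0∞) ∂ν < ∞ ↔ ∫⁻ x, (C (nndist x a) : ℝ≥0∞) ∂ν < ∞ := by
  obtain ⟨Λ, -, hΛ⟩ := hC
  constructor
  · refine fun h => h.trans_le' (lintegral_mono fun x => ?_)
    exact ENNReal.coe_le_coe.2 (hmono (by rw [two_mul]; exact le_self_add))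
  · intro h
    refine (ENNReal.mul_lt_top (ENNReal.coe_lt_top (r := Λ)) h).trans_le' ?_
    rw [← lintegral_const_mul' _ _ ENNReal.coe_ne_top]
    refine lintegral_mono fun x => ?_
    exact (ENNReal.coe_le_coe.2 (hΛ _)).trans_eq (ENNReal.coe_mul _ _)

theorem Doubling.lintegral_lt_top_of_lintegral_lt_top {M : Type*} [MetricSpace M]
    [MeasurableSpace M] {C : ℝ≥0 → ℝ≥0} (hmono : Monotone C) (hC : Doubling C) (ν : Measure M)
    [IsFiniteMeasure ν] {a : M} (h : ∫⁻ x, (C (nndist x a) : ℝ≥0∞) ∂ν < ∞) (b : M) :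
    ∫⁻ x, (C (nndist x b) : ℝ≥0∞) ∂ν < ∞ := by
  obtain ⟨Λ, -, hΛ⟩ := hC
  calc ∫⁻ x, (C (nndist x b) : ℝ≥0∞) ∂ν
      ≤ ∫⁻ x, ((Λ * C (nndist x a) : ℝ≥0∞) + (Λ * C (nndist a b) : ℝ≥0)) ∂ν := by
        refine lintegral_mono fun x => ?_
        rw [← ENNReal.coe_mul, ← ENNReal.coe_add]
        exact ENNReal.coe_le_coe.2
          ((hmono (nndist_triangle x a b)).trans (Doubling.map_add_le hmono hΛ _ _))
    _ = Λ * ∫⁻ x, (C (nndist x a) : ℝ≥0∞) ∂ν + (Λ * C (nndist a b) : ℝ≥0) * ν Set.univ := by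
        rw [lintegral_add_right _ measurable_const, lintegral_const_mul' _ _ ENNReal.coe_ne_top,
          lintegral_const]
    _ < ∞ := ENNReal.add_lt_top.2 ⟨ENNReal.mul_lt_top ENNReal.coe_lt_top h,
        ENNReal.mul_lt_top ENNReal.coe_lt_top (measure_lt_top _ _)⟩

theorem tendsto_transportDist_iff {M : Type*} [MetricSpace M] [TopologicalSpace.SeparableSpace M]
    [MeasurableSpace M] [BorelSpace M] {C : ℝ≥0 → ℝ≥0} (hmono : Monotone C) (hcont : Continuous C)
    (h0 : C 0 = 0) (hC : Doubling C) (hne : ∃ t, C t ≠ 0) {μs : ℕ → ProbabilityMeasure M}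
    {μ : ProbabilityMeasure M} (a : M)
    (hfin : ∫⁻ x, (C (nndist x a) : ℝ≥0∞) ∂(μ : Measure M) ≠ ∞) :
    Tendsto (fun n => transportDist (fun x y => C (nndist x y)) (μs n) μ) atTop (𝓝 0) ↔
      Tendsto μs atTop (𝓝 μ) ∧
      Tendsto (fun n => ∫⁻ x, (C (nndist x a) : ℝ≥0∞) ∂(μs n : Measure M)) atTop
        (𝓝 (∫⁻ x, (C (nndist x a) : ℝ≥0∞) ∂(μ : Measure M))) := by
  have hpos : ∀ s, 0 < s → 0 < C s := fun s hs => hC.pos hmono hne hs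
  exact ⟨fun h => ⟨tendsto_of_tendsto_transportDist hmono hcont hpos h,
    tendsto_moment_of_tendsto_transportDist hmono hcont hpos hC a hfin h⟩,
    fun h => tendsto_transportDist hmono hcont h0 hC a hfin h.1 h.2⟩

theorem tendsto_wassersteinDist_iff {M : Type*} [MetricSpace M] [MeasurableSpace M] {p : ℝ}
    (hp : 0 < p) {μs : ℕ → ProbabilityMeasure M} {μ : ProbabilityMeasure M} :
    Tendsto (fun n => wassersteinDist p (μs n) μ) atTop (𝓝 0) ↔
      Tendsto (fun n => transportDist (fun x y => nndist x y ^ p) (μs n) μ) atTop (𝓝 0) := by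
  constructor
  · intro h
    have := (ENNReal.continuous_rpow_const (y := p)).tendsto 0 |>.comp h
    rw [ENNReal.zero_rpow_of_pos hp] at this
    refine this.congr fun n => ?_
    simp only [wassersteinDist, Function.comp_apply]
    rw [← ENNReal.rpow_mul, one_div_mul_cancel hp.ne', ENNReal.rpow_one]
  · intro h
    have := (ENNReal.continuous_rpow_const (y := 1 / p)).tendsto 0 |>.comp h
    rwa [ENNReal.zero_rpow_of_pos (one_div_pos.2 hp)] at this

theorem corollary1 :
    -- the general criterion
    (∀ (M : Type*) [MetricSpace M] [CompleteSpace M] [TopologicalSpace.SeparableSpace M]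
        [MeasurableSpace M] [BorelSpace M]
        (C : ℝ≥0 → ℝ≥0), Monotone C → Continuous C → C 0 = 0 → Doubling C →
      ∀ (μs : ℕ → ProbabilityMeasure M) (μ : ProbabilityMeasure M),
        -- the two finiteness conditions are equivalent
        (∀ a : M,
          ((∀ n, ∫⁻ x, (C (2 * nndist x a) : ℝ≥0∞) ∂(μs n : Measure M) < ∞) ∧
              ∫⁻ x, (C (2 * nndist x a) : ℝ≥0∞) ∂(μ : Measure M) < ∞) ↔
            ((∀ n, ∫⁻ x, (C (nndist x a) : ℝ≥0∞) ∂(μs n : Measure M) < ∞) ∧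
              ∫⁻ x, (C (nndist x a) : ℝ≥0∞) ∂(μ : Measure M) < ∞)) ∧
        -- if they hold for some base point, then they hold for all of them, and
        -- convergence in `T_c` is characterized, whichever base point is used
        ((∃ a : M,
            (∀ n, ∫⁻ x, (C (2 * nndist x a) : ℝ≥0∞) ∂(μs n : Measure M) < ∞) ∧
              ∫⁻ x, (C (2 * nndist x a) : ℝ≥0∞) ∂(μ : Measure M) < ∞) →
          (∀ a : M,
            (∀ n, ∫⁻ x, (C (2 * nndist x a) : ℝ≥0∞) ∂(μs n : Measure M) < ∞) ∧
              ∫⁻ x, (C (2 * nndist x a) : ℝ≥0∞) ∂(μ : Measure M) < ∞) ∧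
          ((∃ t, C t ≠ 0) → ∀ a : M,
            (Tendsto (fun n => transportDist (fun x y => C (nndist x y)) (μs n) μ)
                atTop (𝓝 0) ↔
              Tendsto μs atTop (𝓝 μ) ∧
              Tendsto (fun n => ∫⁻ x, (C (nndist x a) : ℝ≥0∞) ∂(μs n : Measure M)) atTop
                (𝓝 (∫⁻ x, (C (nndist x a) : ℝ≥0∞) ∂(μ : Measure M))))))) ∧
    -- the criterion for `W_p` on a separable Banach space
    (∀ (B : Type*) [NormedAddCommGroup B] [NormedSpace ℝ B] [CompleteSpace B]
        [TopologicalSpace.SeparableSpace B] [MeasurableSpace B] [BorelSpace B]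
        (p : ℝ), 1 ≤ p →
      ∀ (μs : ℕ → ProbabilityMeasure B) (μ : ProbabilityMeasure B),
        (∀ n, ∫⁻ x, ((‖x‖₊ ^ p : ℝ≥0) : ℝ≥0∞) ∂(μs n : Measure B) < ∞) →
        ∫⁻ x, ((‖x‖₊ ^ p : ℝ≥0) : ℝ≥0∞) ∂(μ : Measure B) < ∞ →
          (Tendsto (fun n => wassersteinDist p (μs n) μ) atTop (𝓝 0) ↔
            Tendsto μs atTop (𝓝 μ) ∧
            Tendsto (fun n => ∫⁻ x, ((‖x‖₊ ^ p : ℝ≥0) : ℝ≥0∞) ∂(μs n : Measure B)) atTop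
              (𝓝 (∫⁻ x, ((‖x‖₊ ^ p : ℝ≥0) : ℝ≥0∞) ∂(μ : Measure B))))) := by
  refine ⟨?_, ?_⟩
  · intro M _ _ _ _ _ C hmono hcont h0 hC μs μ
    -- This makes the two sides of (i) identical.
    simp_rw [hC.lintegral_two_mul_lt_top_iff hmono]
    refine ⟨fun _ => trivial, ?_⟩
    rintro ⟨a, hs, h⟩
    have hall : ∀ b : M, ∫⁻ x, (C (nndist x b) : ℝ≥0∞) ∂(μ : Measure M) < ∞ :=
      hC.lintegral_lt_top_of_lintegral_lt_top hmono _ h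
    exact ⟨fun b => ⟨fun n => hC.lintegral_lt_top_of_lintegral_lt_top hmono _ (hs n) b, hall b⟩,
      fun hne b => tendsto_transportDist_iff hmono hcont h0 hC hne b (hall b).ne⟩
  · intro B _ _ _ _ _ _ p hp μs μ _ hfin
    have hp0 : 0 < p := one_pos.trans_le hp
    rw [tendsto_wassersteinDist_iff hp0]
    have hC : Doubling fun t : ℝ≥0 => t ^ p :=
      ⟨2 ^ p, by positivity, fun y => (NNReal.mul_rpow).le⟩
    -- Norms become distances to the base point `0`.
    simp only [← nndist_zero_right] at hfin ⊢
    exact tendsto_transportDist_iff (C := fun t : ℝ≥0 => t ^ p)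
      (NNReal.monotone_rpow_of_nonneg hp0.le) (NNReal.continuous_rpow_const hp0.le)
      (NNReal.zero_rpow hp0.ne') hC ⟨1, by simp⟩ 0 hfin.ne
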